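/- **Setting.** Let $Q\subset\mathbb R^n$ be compact and let $F=(f_1,\dots,f_k):\mathbb R^n\to\mathbb R^k$ be continuous on $Q$. Let $\epsilon\in\mathbb R^k$ with all $\epsilon_i\ge 0$, and let $0\le\Delta^*<\Delta$ be real numbers. For $v,w\in\mathbb R^k$ write $v\le_p w$ (resp. $v<_p w$) if $v_i\le w_i$ (resp. $v_i<w_i$) for all $i$. The norm $\|\cdot\|_\infty$ is the maximum norm of $\mathbb R^k$, and for a number $c$ the vector $\epsilon+c$ is $(\epsilon_1+c,\dots,\epsilon_k+c)$. * $x$ dominates $y$ if $F(x)\le_p F(y)$ and $F(x)\ne F(y)$. For $\eta\in\mathbb R^k$, $x$ $-\eta$-dominates $y$ (written $x\prec_{-\eta}y$) if $F(x)+\eta\le_p F(y)$ and $F(x)+\eta\neq F(y)$. * $P_Q$ is the set of points of $Q$ not dominated by any point of $Q$, and $P_{Q,\eta}$ is the set of points of $Q$ not $-\eta$-dominated by any point of $Q$. * $x\in Q$ is a weak Pareto point if there is no $y\in Q$ with $F(y)<_pF(x)$. It is a $-\epsilon$ weak Pareto point if there is no $y\in Q$ with $F(y)+\epsilon<_pF(x)$.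 * At a point $x$ where $F$ is differentiable, $q(x)=\sum_{i=1}^k\hat\alpha_i\nabla f_i(x)$, where $\hat\alpha$ minimizes $\|\sum_i\alpha_i\nabla f_i(x)\|_2^2$ over all $\alpha\in\mathbb R^k$ with $\alpha_i\ge 0$ and $\sum_i\alpha_i=1$. * For $A,B\subset\mathbb R^k$, $\operatorname{dist}(B,A)=\sup_{u\in B}\inf_{v\in A}\|u-v\|_\infty\in[0,\infty]$ and $d_H(A,B)=\max\{\operatorname{dist}(A,B),\operatorname{dist}(B,A)\}$. **Assumptions on the problem.** * (A1) There is no weak Pareto point in $Q\setminus P_Q$. * (A2) There is no $-\epsilon$ weak Pareto point in $Q\setminus\overline{P_{Q,\epsilon}}$. * (A3) Let $\mathcal B=\{x\in Q:\exists y\in P_Q,\ F(y)+\epsilon=F(x)\}$. Then $\mathcal B$ is contained in the interior of $Q$, and at every $x\in\mathcal B$ the map $F$ is differentiable and $q(x)\ne 0$. **Algorithm.** $ArchiveUpdateP_{Q,\epsilon}(P,A_0,\Delta)$ starts with $A:=A_0$ and processes the elements $p$ of the finite population $P$ one after the other, in any order. If no $a\in A$ satisfies $a\prec_{-\epsilon}p$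 and no $a\in A$ satisfies $\|F(a)-F(p)\|_\infty\le\Delta^*$, then $p$ is added to $A$ and afterwards every $a\in A$ with $p\prec_{-(\epsilon+\Delta)}a$ is removed from $A$. Otherwise $A$ is left unchanged. The final $A$ is returned. Let $P_0,P_1,P_2,\dots$ be any sequence of random finite subsets of $Q$ (the populations of the generation process), and let $A_0=ArchiveUpdateP_{Q,\epsilon}(P_0,\emptyset,\Delta)$ and $A_{j+1}=ArchiveUpdateP_{Q,\epsilon}(P_{j+1},A_j,\Delta)$ for $j\ge 0$. **Theorem.** Suppose in addition that for every $x\in Q$ and every $\delta>0$, with probability one there is an $l\in\mathbb N$ with $P_l\cap B_\delta(x)\cap Q\ne\emptyset$. Then the following holds. * (a) For all $l\in\mathbb N$ and all $a_1\neq a_2$ in $A_l$: $\|F(a_1)-F(a_2)\|_\infty\ge\Delta^*$. * (b) With probability one there is an $l_0\in\mathbb N$ such that for all $l\ge l_0$: * (b1) $\operatorname{dist}(F(P_{Q,\epsilon}),F(A_l))<\Delta$; * (b2) $\operatorname{dist}(F(A_l),F(P_{Q,\epsilon}))\le\operatorname{dist}(F(P_{Q,\epsilon+2\Delta}),F(P_{Q,\epsilon}))$;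 * (b3) $d_H(F(P_{Q,\epsilon}),F(A_l))\le\max\{\Delta,\ \operatorname{dist}(F(P_{Q,\epsilon+2\Delta}),F(P_{Q,\epsilon}))\}$. -/

import Mathlib

open MeasureTheory

/-- `x` dominates `y`: `F x ≤ F y` componentwise and `F x ≠ F y`. -/
def Dominates {n k : ℕ} (F : EuclideanSpace ℝ (Fin n) → Fin k → ℝ)
    (x y : EuclideanSpace ℝ (Fin n)) : Prop :=
  F x ≤ F y ∧ F x ≠ F y

/-- `x` `-ε`-dominates `y`: `F x + ε ≤ F y` componentwise and `F x + ε ≠ F y`. -/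
def NegDominates {n k : ℕ} (F : EuclideanSpace ℝ (Fin n) → Fin k → ℝ) (ε : Fin k → ℝ)
    (x y : EuclideanSpace ℝ (Fin n)) : Prop :=
  F x + ε ≤ F y ∧ F x + ε ≠ F y

/-- The Pareto set `P_Q`: points of `Q` which no point of `Q` dominates. -/
def paretoSet {n k : ℕ} (F : EuclideanSpace ℝ (Fin n) → Fin k → ℝ)
    (Q : Set (EuclideanSpace ℝ (Fin n))) : Set (EuclideanSpace ℝ (Fin n)) :=
  {x | x ∈ Q ∧ ¬ ∃ y ∈ Q, Dominates F y x}

/-- The set `P_{Q,ε}`: points of `Q` which no point of `Q` `-ε`-dominates. -/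
def approxParetoSet {n k : ℕ} (F : EuclideanSpace ℝ (Fin n) → Fin k → ℝ)
    (Q : Set (EuclideanSpace ℝ (Fin n))) (ε : Fin k → ℝ) : Set (EuclideanSpace ℝ (Fin n)) :=
  {x | x ∈ Q ∧ ¬ ∃ y ∈ Q, NegDominates F ε y x}

/-- `x ∈ Q` is a weak Pareto point: no `y ∈ Q` is strictly smaller in every objective. -/
def IsWeakPareto {n k : ℕ} (F : EuclideanSpace ℝ (Fin n) → Fin k → ℝ)
    (Q : Set (EuclideanSpace ℝ (Fin n))) (x : EuclideanSpace ℝ (Fin n)) : Prop :=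
  x ∈ Q ∧ ¬ ∃ y ∈ Q, ∀ i, F y i < F x i

/-- `x ∈ Q` is a `-ε` weak Pareto point: no `y ∈ Q` has `F y + ε` strictly smaller than `F x`
in every objective. -/
def IsNegWeakPareto {n k : ℕ} (F : EuclideanSpace ℝ (Fin n) → Fin k → ℝ)
    (Q : Set (EuclideanSpace ℝ (Fin n))) (ε : Fin k → ℝ) (x : EuclideanSpace ℝ (Fin n)) : Prop :=
  x ∈ Q ∧ ¬ ∃ y ∈ Q, ∀ i, F y i + ε i < F x i

/-- The convex combination `∑ i, α i • ∇ f_i (x)` of the gradients of the objectives. -/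
noncomputable def gradComb {n k : ℕ} (F : EuclideanSpace ℝ (Fin n) → Fin k → ℝ)
    (x : EuclideanSpace ℝ (Fin n)) (α : Fin k → ℝ) : EuclideanSpace ℝ (Fin n) :=
  ∑ i, α i • gradient (fun y => F y i) x

/-- `α` solves the quadratic problem
`min ‖∑ i, α i • ∇ f_i (x)‖ ^ 2` subject to `α i ≥ 0` and `∑ i, α i = 1`. -/
def SolvesQP {n k : ℕ} (F : EuclideanSpace ℝ (Fin n) → Fin k → ℝ)
    (x : EuclideanSpace ℝ (Fin n)) (α : Fin k → ℝ) : Prop :=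
  α ∈ stdSimplex ℝ (Fin k) ∧
    ∀ β ∈ stdSimplex ℝ (Fin k), ‖gradComb F x α‖ ^ 2 ≤ ‖gradComb F x β‖ ^ 2

/-- For at least one objective the quadratic problem has a solution. -/
theorem exists_solvesQP {n k : ℕ} (hk : 0 < k) (F : EuclideanSpace ℝ (Fin n) → Fin k → ℝ)
    (x : EuclideanSpace ℝ (Fin n)) : ∃ α, SolvesQP F x α := by
  have hne : (stdSimplex ℝ (Fin k)).Nonempty := ⟨_, single_mem_stdSimplex ℝ (⟨0, hk⟩ : Fin k)⟩
  have hc : Continuous fun α : Fin k → ℝ => ‖gradComb F x α‖ ^ 2 := by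
    unfold gradComb
    fun_prop
  obtain ⟨α, hα, hmin⟩ := (isCompact_stdSimplex ℝ (Fin k)).exists_isMinOn hne hc.continuousOn
  exact ⟨α, hα, fun β hβ => hmin hβ⟩

open Classical in
/-- The vector `q x = ∑ i, α i • ∇ f_i (x)`, where `α` is a solution of the quadratic problem.
It does not depend on the solution chosen, being the element of least norm of the convex hull of
the gradients. The value `0` is used only when there are no objectives (`k = 0`). -/
noncomputable def qVec {n k : ℕ} (F : EuclideanSpace ℝ (Fin n) → Fin k → ℝ)
    (x : EuclideanSpace ℝ (Fin n)) : EuclideanSpace ℝ (Fin n) :=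
  if h : ∃ α, SolvesQP F x α then gradComb F x h.choose else 0

/-- The set `𝓑` of points `x ∈ Q` with `F x = F y + ε` for some Pareto point `y`. -/
def shiftedParetoSet {n k : ℕ} (F : EuclideanSpace ℝ (Fin n) → Fin k → ℝ)
    (Q : Set (EuclideanSpace ℝ (Fin n))) (ε : Fin k → ℝ) : Set (EuclideanSpace ℝ (Fin n)) :=
  {x | x ∈ Q ∧ ∃ y ∈ paretoSet F Q, F y + ε = F x}

open Classical in
/-- Processing of one candidate `p` by the archiver. The candidate is accepted if no archive
member `-ε`-dominates it and none has an image within `∞`-distance `Δs` of its image. On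
acceptance, all members which `p` `-(ε + Δ)`-dominates are removed. -/
noncomputable def archiveStep {n k : ℕ} (F : EuclideanSpace ℝ (Fin n) → Fin k → ℝ)
    (ε : Fin k → ℝ) (Δ Δs : ℝ) (A : Finset (EuclideanSpace ℝ (Fin n)))
    (p : EuclideanSpace ℝ (Fin n)) : Finset (EuclideanSpace ℝ (Fin n)) :=
  if (¬ ∃ a ∈ A, NegDominates F ε a p) ∧ ¬ ∃ a ∈ A, ‖F a - F p‖ ≤ Δs then
    (insert p A).filter fun a => ¬ NegDominates F (fun i => ε i + Δ) p a
  else A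

/-- `A` is a possible result of updating the archive `A₀` with the population `P`: the members of
`P` are processed one after the other, in some order. -/
def IsArchiveUpdate {n k : ℕ} (F : EuclideanSpace ℝ (Fin n) → Fin k → ℝ)
    (ε : Fin k → ℝ) (Δ Δs : ℝ) (P A₀ A : Finset (EuclideanSpace ℝ (Fin n))) : Prop :=
  ∃ L : List (EuclideanSpace ℝ (Fin n)),
    L.Nodup ∧ (∀ p, p ∈ L ↔ p ∈ P) ∧ A = L.foldl (archiveStep F ε Δ Δs) A₀

/-- `A` is a sequence of archives which the generic search algorithm produces from the
populations `P 0, P 1, …`: `A 0` is an update of the empty archive with `P 0`, and `A (j + 1)` is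
an update of `A j` with `P (j + 1)`. -/
def IsArchiveSequence {n k : ℕ} (F : EuclideanSpace ℝ (Fin n) → Fin k → ℝ)
    (ε : Fin k → ℝ) (Δ Δs : ℝ) (P A : ℕ → Finset (EuclideanSpace ℝ (Fin n))) : Prop :=
  IsArchiveUpdate F ε Δ Δs (P 0) ∅ (A 0) ∧
    ∀ j, IsArchiveUpdate F ε Δ Δs (P (j + 1)) (A j) (A (j + 1))

/-- The semi-distance `dist(B, A) = sup_{u ∈ B} inf_{v ∈ A} ‖u - v‖_∞` in the image space, with
values in `[0, ∞]`. -/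
noncomputable def semiDist {k : ℕ} (B A : Set (Fin k → ℝ)) : ENNReal :=
  ⨆ u ∈ B, ⨅ v ∈ A, edist u v

/-- The Hausdorff distance `d_H(A, B) = max (dist(A, B), dist(B, A))`. -/
noncomputable def hausDist {k : ℕ} (A B : Set (Fin k → ℝ)) : ENNReal :=
  max (semiDist A B) (semiDist B A)

/-! Random populations hit only neighbourhoods, so `approxParetoSet` is replaced by the relatively
open set S = `strictApproxSet` (`strictApproxSet_nhds`). A sample `p` in S is never rejected for
domination: it is accepted, or some member already lies within `Δs` of its image. A member whose
image is within `Δ` of `F s`, with `s` in S, can never be removed, so one good sample settles `s`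
forever (`IsArchiveSequence.eventually_near`). A finite net of the totally bounded set `F '' S`
makes this uniform. Points of `approxParetoSet` outside S lie in `shiftedParetoSet`; there (A3)
gives a common descent direction, which leads into S with arbitrarily close images
(`exists_strictApproxSet_near`). This yields (b1). For (b2), members never `-(ε + Δ)`-dominate each
other, while every Pareto image has a member within `Δ`. A point `-(ε + 2Δ)`-dominating a member
would thus produce such a forbidden pair (`subset_approxParetoSet_of_approx`). -/

theorem not_negDominates_self {n k : ℕ} (F : EuclideanSpace ℝ (Fin n) → Fin k → ℝ)
    {η : Fin k → ℝ} (hη : 0 ≤ η) (x : EuclideanSpace ℝ (Fin n)) : ¬ NegDominates F η x x := by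
  rintro ⟨h, hne⟩
  exact hne (le_antisymm h (le_add_of_nonneg_right hη))

theorem NegDominates.mono {n k : ℕ} {F : EuclideanSpace ℝ (Fin n) → Fin k → ℝ}
    {η ζ : Fin k → ℝ} {x y : EuclideanSpace ℝ (Fin n)} (h : NegDominates F ζ x y) (hηζ : η ≤ ζ) :
    NegDominates F η x y := by
  have hle : F x + η ≤ F x + ζ := by gcongr
  refine ⟨hle.trans h.1, fun heq => h.2 (le_antisymm h.1 (heq ▸ hle))⟩

/-! ### The archive -/

theorem mem_archiveStep_self {n k : ℕ} {F : EuclideanSpace ℝ (Fin n) → Fin k → ℝ}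
    {ε : Fin k → ℝ} {Δ Δs : ℝ} {A : Finset (EuclideanSpace ℝ (Fin n))}
    {p : EuclideanSpace ℝ (Fin n)} (hε : ∀ i, 0 ≤ ε i + Δ)
    (h₁ : ¬ ∃ a ∈ A, NegDominates F ε a p) (h₂ : ¬ ∃ a ∈ A, ‖F a - F p‖ ≤ Δs) :
    p ∈ archiveStep F ε Δ Δs A p := by
  rw [archiveStep, if_pos ⟨h₁, h₂⟩]
  simpa using not_negDominates_self F hε p

theorem archiveStep_subset_insert {n k : ℕ} [DecidableEq (EuclideanSpace ℝ (Fin n))]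
    (F : EuclideanSpace ℝ (Fin n) → Fin k → ℝ)
    (ε : Fin k → ℝ) (Δ Δs : ℝ) (A : Finset (EuclideanSpace ℝ (Fin n)))
    (p : EuclideanSpace ℝ (Fin n)) : archiveStep F ε Δ Δs A p ⊆ insert p A := by
  intro a ha
  rw [archiveStep] at ha
  classical
  split_ifs at ha
  · simpa using (Finset.mem_filter.1 ha).1
  · exact Finset.mem_insert_of_mem ha

/-- A member of the archive stays there when no point `-(ε + Δ)`-dominates it. -/
theorem mem_archiveStep_of_mem {n k : ℕ} {F : EuclideanSpace ℝ (Fin n) → Fin k → ℝ}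
    {ε : Fin k → ℝ} {Δ Δs : ℝ} {A : Finset (EuclideanSpace ℝ (Fin n))}
    {p a : EuclideanSpace ℝ (Fin n)} (ha : a ∈ A)
    (h : ¬ NegDominates F (fun i => ε i + Δ) p a) : a ∈ archiveStep F ε Δ Δs A p := by
  classical
  rw [archiveStep]
  split_ifs
  · exact Finset.mem_filter.2 ⟨Finset.mem_insert_of_mem ha, h⟩
  · exact ha

theorem pairwise_archiveStep {n k : ℕ} {F : EuclideanSpace ℝ (Fin n) → Fin k → ℝ}
    {ε : Fin k → ℝ} {Δ Δs : ℝ} {A : Finset (EuclideanSpace ℝ (Fin n))}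
    (p : EuclideanSpace ℝ (Fin n))
    (h : ∀ a₁ ∈ A, ∀ a₂ ∈ A, a₁ ≠ a₂ → Δs ≤ ‖F a₁ - F a₂‖) :
    ∀ a₁ ∈ archiveStep F ε Δ Δs A p, ∀ a₂ ∈ archiveStep F ε Δ Δs A p,
      a₁ ≠ a₂ → Δs ≤ ‖F a₁ - F a₂‖ := by
  rw [archiveStep]
  split_ifs with hc
  · have hp : ∀ a ∈ A, Δs ≤ ‖F a - F p‖ := fun a ha => by
      by_contra! hlt
      exact hc.2 ⟨a, ha, hlt.le⟩
    simp only [Finset.mem_filter, Finset.mem_insert]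
    rintro a₁ ⟨rfl | h₁, -⟩ a₂ ⟨rfl | h₂, -⟩ hne
    · exact absurd rfl hne
    · rw [norm_sub_rev]
      exact hp a₂ h₂
    · exact hp a₁ h₁
    · exact h a₁ h₁ a₂ h₂ hne
  · exact h

/-- The filter deletes what `p` dominates; conversely, acceptance of `p` excludes even
`-ε`-domination by older members, which is weaker since `0 ≤ Δ`. -/
theorem not_negDominates_archiveStep {n k : ℕ} {F : EuclideanSpace ℝ (Fin n) → Fin k → ℝ}
    {ε : Fin k → ℝ} {Δ Δs : ℝ} {A : Finset (EuclideanSpace ℝ (Fin n))} (hΔ : 0 ≤ Δ)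
    (p : EuclideanSpace ℝ (Fin n))
    (h : ∀ a₁ ∈ A, ∀ a₂ ∈ A, ¬ NegDominates F (fun i => ε i + Δ) a₁ a₂) :
    ∀ a₁ ∈ archiveStep F ε Δ Δs A p, ∀ a₂ ∈ archiveStep F ε Δ Δs A p,
      ¬ NegDominates F (fun i => ε i + Δ) a₁ a₂ := by
  rw [archiveStep]
  split_ifs with hc
  · simp only [Finset.mem_filter, Finset.mem_insert]
    rintro a₁ ⟨rfl | h₁, -⟩ a₂ ⟨h₂, h₂'⟩
    · exact h₂'
    · rcases h₂ with rfl | h₂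
      · exact fun hd => hc.1 ⟨a₁, h₁, hd.mono fun i => le_add_of_nonneg_right hΔ⟩
      · exact h a₁ h₁ a₂ h₂
  · exact h

theorem List.foldl_preserves {α β : Type*} {f : β → α → β} {motive : β → Prop} {L : List α}
    (h : ∀ b, ∀ a ∈ L, motive b → motive (f b a)) {b : β} (hb : motive b) :
    motive (L.foldl f b) := by
  induction L generalizing b with
  | nil => exact hb
  | cons a L ih =>
    exact ih (fun b c hc => h b c (List.mem_cons_of_mem _ hc)) (h b a List.mem_cons_self hb)

/-- A property preserved by the processing of each member of the population is preserved by an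
update. -/
theorem IsArchiveUpdate.preserves {n k : ℕ} {F : EuclideanSpace ℝ (Fin n) → Fin k → ℝ}
    {ε : Fin k → ℝ} {Δ Δs : ℝ} {P A₀ A : Finset (EuclideanSpace ℝ (Fin n))}
    (h : IsArchiveUpdate F ε Δ Δs P A₀ A) {motive : Finset (EuclideanSpace ℝ (Fin n)) → Prop}
    (hstep : ∀ B, ∀ p ∈ P, motive B → motive (archiveStep F ε Δ Δs B p)) (h₀ : motive A₀) :
    motive A := by
  obtain ⟨L, -, hL, rfl⟩ := h
  exact List.foldl_preserves (fun B p hp => hstep B p ((hL p).1 hp)) h₀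

/-- A property that processing `p` establishes (under an invariant `I`), and that later steps
preserve, holds after an update with a population containing `p`. -/
theorem IsArchiveUpdate.establishes {n k : ℕ} {F : EuclideanSpace ℝ (Fin n) → Fin k → ℝ}
    {ε : Fin k → ℝ} {Δ Δs : ℝ} {P A₀ A : Finset (EuclideanSpace ℝ (Fin n))}
    (h : IsArchiveUpdate F ε Δ Δs P A₀ A) {I motive : Finset (EuclideanSpace ℝ (Fin n)) → Prop}
    {p : EuclideanSpace ℝ (Fin n)} (hp : p ∈ P)
    (hI : ∀ B, ∀ q ∈ P, I B → I (archiveStep F ε Δ Δs B q)) (h₀ : I A₀)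
    (hest : ∀ B, I B → motive (archiveStep F ε Δ Δs B p))
    (hstep : ∀ B, ∀ q ∈ P, motive B → motive (archiveStep F ε Δ Δs B q)) :
    motive A := by
  obtain ⟨L, -, hL, rfl⟩ := h
  obtain ⟨L₁, L₂, rfl⟩ := List.append_of_mem ((hL p).2 hp)
  rw [List.foldl_append, List.foldl_cons]
  refine List.foldl_preserves (fun B q hq => hstep B q ((hL q).1 (by simp [hq]))) (hest _ ?_)
  exact List.foldl_preserves (fun B q hq => hI B q ((hL q).1 (by simp [hq]))) h₀

theorem IsArchiveSequence.invariant {n k : ℕ} {F : EuclideanSpace ℝ (Fin n) → Fin k → ℝ}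
    {ε : Fin k → ℝ} {Δ Δs : ℝ} {P A : ℕ → Finset (EuclideanSpace ℝ (Fin n))}
    (h : IsArchiveSequence F ε Δ Δs P A) {motive : Finset (EuclideanSpace ℝ (Fin n)) → Prop}
    (hstep : ∀ B j, ∀ p ∈ P j, motive B → motive (archiveStep F ε Δ Δs B p))
    (h₀ : motive ∅) (l : ℕ) : motive (A l) := by
  induction l with
  | zero => exact h.1.preserves (fun B => hstep B 0) h₀
  | succ l ih => exact (h.2 l).preserves (fun B => hstep B (l + 1)) ih

/-- Turns a single sampling event into a permanent property: `I` is available when `p` is processed,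
whatever the order within its population. -/
theorem IsArchiveSequence.eventually {n k : ℕ} {F : EuclideanSpace ℝ (Fin n) → Fin k → ℝ}
    {ε : Fin k → ℝ} {Δ Δs : ℝ} {P A : ℕ → Finset (EuclideanSpace ℝ (Fin n))}
    (h : IsArchiveSequence F ε Δ Δs P A) {I motive : Finset (EuclideanSpace ℝ (Fin n)) → Prop}
    {l : ℕ} {p : EuclideanSpace ℝ (Fin n)} (hp : p ∈ P l)
    (hI : ∀ B j, ∀ q ∈ P j, I B → I (archiveStep F ε Δ Δs B q)) (h₀ : I ∅)
    (hest : ∀ B, I B → motive (archiveStep F ε Δ Δs B p))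
    (hstep : ∀ B j, ∀ q ∈ P j, motive B → motive (archiveStep F ε Δ Δs B q)) :
    ∀ m ≥ l, motive (A m) := by
  intro m hm
  induction m, hm using Nat.le_induction with
  | base =>
    cases l with
    | zero => exact h.1.establishes hp (fun B => hI B 0) h₀ hest fun B => hstep B 0
    | succ l =>
      exact (h.2 l).establishes hp (fun B => hI B (l + 1)) (h.invariant hI h₀ l) hest
        fun B => hstep B (l + 1)
  | succ m _ ih => exact (h.2 m).preserves (fun B => hstep B (m + 1)) ih

theorem archiveStep_subset {n k : ℕ} {F : EuclideanSpace ℝ (Fin n) → Fin k → ℝ}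
    {ε : Fin k → ℝ} {Δ Δs : ℝ} {A : Finset (EuclideanSpace ℝ (Fin n))}
    {Q : Set (EuclideanSpace ℝ (Fin n))} (hA : ∀ a ∈ A, a ∈ Q) {p : EuclideanSpace ℝ (Fin n)}
    (hp : p ∈ Q) : ∀ a ∈ archiveStep F ε Δ Δs A p, a ∈ Q := by
  classical
  intro a ha
  rcases Finset.mem_insert.1 (archiveStep_subset_insert F ε Δ Δs A p ha) with rfl | h
  · exact hp
  · exact hA a h

/-! ### Points that are not weakly `-ε`-dominated -/

/-- The points `x` of `Q` for which no `y ∈ Q` satisfies `F y + ε ≤ F x`. -/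
def strictApproxSet {n k : ℕ} (F : EuclideanSpace ℝ (Fin n) → Fin k → ℝ)
    (Q : Set (EuclideanSpace ℝ (Fin n))) (ε : Fin k → ℝ) : Set (EuclideanSpace ℝ (Fin n)) :=
  {x | x ∈ Q ∧ ¬ ∃ y ∈ Q, F y + ε ≤ F x}

-- The values weakly dominated after the shift form `F '' Q + Set.Ici ε`, a compact set plus a
-- closed one, hence closed; continuity on `Q` does the rest.
open scoped Pointwise in
theorem strictApproxSet_nhds {n k : ℕ} {F : EuclideanSpace ℝ (Fin n) → Fin k → ℝ}
    {Q : Set (EuclideanSpace ℝ (Fin n))} (hQ : IsCompact Q) (hF : ContinuousOn F Q)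
    {ε : Fin k → ℝ} {s : EuclideanSpace ℝ (Fin n)} (hs : s ∈ strictApproxSet F Q ε)
    {η : ℝ} (hη : 0 < η) :
    ∃ δ > 0, ∀ p ∈ Metric.ball s δ ∩ Q, p ∈ strictApproxSet F Q ε ∧ ‖F p - F s‖ < η := by
  have hclosed : IsClosed (F '' Q + Set.Ici ε) :=
    isClosed_Ici.add_left_of_isCompact (hQ.image_of_continuousOn hF)
  have hmem : ∀ v, v ∈ F '' Q + Set.Ici ε ↔ ∃ y ∈ Q, F y + ε ≤ v := by
    intro v
    constructor
    · rintro ⟨_, ⟨y, hy, rfl⟩, e, he, rfl⟩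
      exact ⟨y, hy, add_le_add_right (Set.mem_Ici.1 he) _⟩
    · rintro ⟨y, hy, hv⟩
      exact ⟨F y, ⟨y, hy, rfl⟩, v - F y, le_sub_iff_add_le'.2 hv, add_sub_cancel _ _⟩
  have h₁ : ∀ᶠ p in nhdsWithin s Q, F p ∈ (F '' Q + Set.Ici ε)ᶜ :=
    (hF s hs.1).eventually (hclosed.isOpen_compl.mem_nhds fun h => hs.2 ((hmem _).1 h))
  have h₂ : ∀ᶠ p in nhdsWithin s Q, F p ∈ Metric.ball (F s) η :=
    (hF s hs.1).eventually (Metric.ball_mem_nhds _ hη)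
  obtain ⟨δ, hδ, h⟩ := Metric.mem_nhdsWithin_iff.1 (h₁.and h₂)
  refine ⟨δ, hδ, fun p hp => ⟨⟨hp.2, fun hd => (h hp).1 ((hmem _).2 hd)⟩, ?_⟩⟩
  simpa [dist_eq_norm] using (h hp).2

/-- The element of least norm of the convex hull of the gradients makes an acute angle with each
of them. -/
theorem SolvesQP.inner_gradient_pos {n k : ℕ} {F : EuclideanSpace ℝ (Fin n) → Fin k → ℝ}
    {x : EuclideanSpace ℝ (Fin n)} {α : Fin k → ℝ} (h : SolvesQP F x α)
    (hne : gradComb F x α ≠ 0) (i : Fin k) :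
    0 < inner ℝ (gradient (fun y => F y i) x) (gradComb F x α) := by
  set q := gradComb F x α with hq
  set g := gradient (fun y => F y i) x with hg
  have hlin : ∀ t : ℝ, gradComb F x ((1 - t) • α + t • Pi.single i 1) = (1 - t) • q + t • g := by
    intro t
    simp only [gradComb, hq, hg, Pi.add_apply, Pi.smul_apply, smul_eq_mul, add_smul,
      Finset.sum_add_distrib, mul_smul, ← Finset.smul_sum]
    congr 2
    simp [Pi.single_apply]
  -- First-order optimality: `q` is compared with `q + t • (g - q)` and the inequality divided by
  -- `t`. Letting `t` tend to 0 gives `‖q‖ ^ 2 ≤ inner ℝ g q`.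
  have key : ∀ t ∈ Set.Ioc (0 : ℝ) 1, 2 * (‖q‖ ^ 2 - inner ℝ g q) ≤ t * ‖g - q‖ ^ 2 := by
    intro t ht
    have hmem : (1 - t) • α + t • Pi.single i 1 ∈ stdSimplex ℝ (Fin k) :=
      convex_stdSimplex ℝ (Fin k) h.1 (single_mem_stdSimplex ℝ i) (by linarith [ht.2]) ht.1.le
        (by ring)
    have h₁ := h.2 _ hmem
    rw [hlin, show (1 - t) • q + t • g = q + t • (g - q) by module, norm_add_sq_real,
      inner_smul_right, norm_smul, mul_pow, inner_sub_right, real_inner_self_eq_norm_sq,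
      real_inner_comm, Real.norm_eq_abs, sq_abs] at h₁
    have h₂ : t * (2 * (‖q‖ ^ 2 - inner ℝ g q)) ≤ t * (t * ‖g - q‖ ^ 2) := by
      simp only [← hq] at h₁
      linarith
    exact le_of_mul_le_mul_left h₂ ht.1
  have hle : 2 * (‖q‖ ^ 2 - inner ℝ g q) ≤ 0 := by
    have hlim : Filter.Tendsto (fun t : ℝ => t * ‖g - q‖ ^ 2) (nhdsWithin 0 (Set.Ioi 0))
        (nhds 0) := by
      have : Continuous fun t : ℝ => t * ‖g - q‖ ^ 2 := by fun_prop
      simpa using (this.tendsto 0).mono_left nhdsWithin_le_nhds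
    refine ge_of_tendsto hlim ?_
    filter_upwards [Ioc_mem_nhdsGT (zero_lt_one' ℝ)] with t ht using key t ht
  have hpos : 0 < ‖q‖ ^ 2 := by positivity
  linarith

/-- Moving against the gradient combination of least norm decreases all objectives. -/
theorem exists_descent_of_qVec_ne_zero {n k : ℕ} {F : EuclideanSpace ℝ (Fin n) → Fin k → ℝ}
    {x : EuclideanSpace ℝ (Fin n)} (hd : DifferentiableAt ℝ F x) (hq : qVec F x ≠ 0)
    {U : Set (EuclideanSpace ℝ (Fin n))} (hU : U ∈ nhds x) :
    ∃ z ∈ U, ∀ i, F z i < F x i := by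
  have hpos : ∀ i, 0 < inner ℝ (gradient (fun y => F y i) x) (qVec F x) := by
    rw [qVec] at hq ⊢
    split_ifs at hq ⊢ with h
    · exact fun i => h.choose_spec.inner_gradient_pos hq i
    · exact absurd rfl hq
  set q := qVec F x
  have hline : HasDerivAt (fun t : ℝ => x - t • q) (-q) 0 := by
    simpa using ((hasDerivAt_id (0 : ℝ)).smul_const q).const_sub x
  have hdesc : ∀ i, ∀ᶠ t : ℝ in nhdsWithin 0 (Set.Ioi 0), F (x - t • q) i < F x i := by
    intro i
    have hgi : HasGradientAt (fun y => F y i) (gradient (fun y => F y i) x) x :=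
      (differentiableAt_pi.1 hd i).hasGradientAt
    have hfd := hgi.hasFDerivAt
    have hder : HasDerivAt (fun t : ℝ => F (x - t • q) i)
        (-inner ℝ (gradient (fun y => F y i) x) q) 0 := by
      have := HasFDerivAt.comp_hasDerivAt_of_eq (0 : ℝ) hfd hline (by simp)
      simpa [Function.comp_def] using this
    have hslope := (hasDerivAt_iff_tendsto_slope.1 hder).mono_left
      (nhdsWithin_mono (0 : ℝ) fun t (ht : t ∈ Set.Ioi 0) => ne_of_gt ht)
    filter_upwards [hslope.eventually (gt_mem_nhds (neg_lt_zero.2 (hpos i))),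
      self_mem_nhdsWithin] with t ht ht0
    rw [slope_def_field, div_neg_iff] at ht
    have ht0' : (0 : ℝ) < t := ht0
    rcases ht with ⟨-, h⟩ | ⟨h, -⟩
    · linarith
    · simpa using h
  have hmem : ∀ᶠ t : ℝ in nhdsWithin 0 (Set.Ioi 0), x - t • q ∈ U := by
    have : Filter.Tendsto (fun t : ℝ => x - t • q) (nhds 0) (nhds x) := by
      simpa using hline.continuousAt.tendsto
    exact (this.mono_left nhdsWithin_le_nhds).eventually hU
  obtain ⟨t, ht, htU⟩ := ((Filter.eventually_all.2 hdesc).and hmem).exists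
  exact ⟨_, htU, ht⟩

/-- If `x` is not itself in the strict set, then `F y + ε = F x` for some Pareto point `y`. Any `z`
near `x` with all objectives smaller is then strict: `F w + ε ≤ F z` would make `w` `-ε`-dominate
`x`. -/
theorem exists_strictApproxSet_near {n k : ℕ} {F : EuclideanSpace ℝ (Fin n) → Fin k → ℝ}
    {Q : Set (EuclideanSpace ℝ (Fin n))} {ε : Fin k → ℝ}
    (hA3 : shiftedParetoSet F Q ε ⊆ interior Q)
    (hA3' : ∀ x ∈ shiftedParetoSet F Q ε, DifferentiableAt ℝ F x ∧ qVec F x ≠ 0)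
    {x : EuclideanSpace ℝ (Fin n)} (hx : x ∈ approxParetoSet F Q ε) {η : ℝ} (hη : 0 < η) :
    ∃ s ∈ strictApproxSet F Q ε, ‖F x - F s‖ < η := by
  by_cases hxs : x ∈ strictApproxSet F Q ε
  · exact ⟨x, hxs, by simpa using hη⟩
  obtain ⟨y, hy, hyx⟩ : ∃ y ∈ Q, F y + ε ≤ F x := by
    by_contra h
    exact hxs ⟨hx.1, h⟩
  have heq : F y + ε = F x := by
    by_contra h
    exact hx.2 ⟨y, hy, hyx, h⟩
  have hyP : y ∈ paretoSet F Q := by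
    refine ⟨hy, ?_⟩
    rintro ⟨z, hz, hzy, hne⟩
    refine hx.2 ⟨z, hz, heq ▸ by gcongr, fun h => hne ?_⟩
    exact add_right_cancel (h.trans heq.symm)
  have hxB : x ∈ shiftedParetoSet F Q ε := ⟨hx.1, y, hyP, heq⟩
  obtain ⟨hd, hq⟩ := hA3' x hxB
  have hU : Q ∩ F ⁻¹' Metric.ball (F x) η ∈ nhds x :=
    Filter.inter_mem (mem_interior_iff_mem_nhds.1 (hA3 hxB))
      (hd.continuousAt (Metric.ball_mem_nhds _ hη))
  obtain ⟨z, ⟨hzQ, hzη⟩, hlt⟩ := exists_descent_of_qVec_ne_zero hd hq hU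
  refine ⟨z, ⟨hzQ, ?_⟩, by simpa [dist_eq_norm, norm_sub_rev] using hzη⟩
  rintro ⟨w, hw, hwz⟩
  refine hx.2 ⟨w, hw, hwz.trans fun i => (hlt i).le, fun h => hq ?_⟩
  -- Without objectives, descent is vacuous and gives no contradiction; but then `qVec` vanishes,
  -- against `hq`.
  rcases isEmpty_or_nonempty (Fin k) with hk | ⟨⟨i⟩⟩
  · rw [qVec]
    split_ifs
    · simp [gradComb]
    · rfl
  · exact absurd (hwz i) (not_le.2 (h ▸ hlt i))

/-! ### Pareto points -/

theorem exists_paretoSet_le {n k : ℕ} {F : EuclideanSpace ℝ (Fin n) → Fin k → ℝ}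
    {Q : Set (EuclideanSpace ℝ (Fin n))} (hQ : IsCompact Q) (hF : ContinuousOn F Q)
    {y : EuclideanSpace ℝ (Fin n)} (hy : y ∈ Q) : ∃ z ∈ paretoSet F Q, F z ≤ F y := by
  have hK : IsCompact (F '' Q ∩ Set.Iic (F y)) :=
    (hQ.image_of_continuousOn hF).inter_right isClosed_Iic
  -- A minimizer of the coordinate sum among the values below `F y` is Pareto, as domination
  -- strictly lowers the sum.
  have hc : Continuous fun v : Fin k → ℝ => ∑ i, v i := by fun_prop
  obtain ⟨_, ⟨⟨z, hz, rfl⟩, hzy⟩, hmin⟩ :=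
    hK.exists_isMinOn ⟨F y, ⟨y, hy, rfl⟩, Set.mem_Iic.2 le_rfl⟩ hc.continuousOn
  refine ⟨z, ⟨hz, ?_⟩, hzy⟩
  rintro ⟨w, hw, hle, hne⟩
  have h₁ : ∑ i, F z i ≤ ∑ i, F w i := hmin ⟨⟨w, hw, rfl⟩, hle.trans hzy⟩
  obtain ⟨i, hi⟩ := (Pi.lt_def.1 (lt_of_le_of_ne hle hne)).2
  exact absurd (Finset.sum_lt_sum (fun j _ => hle j) ⟨i, Finset.mem_univ i, hi⟩) (not_lt.2 h₁)

theorem paretoSet_subset_approxParetoSet {n k : ℕ} (F : EuclideanSpace ℝ (Fin n) → Fin k → ℝ)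
    (Q : Set (EuclideanSpace ℝ (Fin n))) {ε : Fin k → ℝ} (hε : 0 ≤ ε) :
    paretoSet F Q ⊆ approxParetoSet F Q ε := by
  rintro x ⟨hx, hnd⟩
  refine ⟨hx, ?_⟩
  rintro ⟨y, hy, hd⟩
  exact hnd ⟨y, hy, by simpa [NegDominates, Dominates] using hd.mono hε⟩

/-! ### Convergence of the archives -/

/-- Once a population contains a point near `s`, the image of `s` stays approximated. -/
theorem IsArchiveSequence.eventually_near {n k : ℕ} {F : EuclideanSpace ℝ (Fin n) → Fin k → ℝ}
    {Q : Set (EuclideanSpace ℝ (Fin n))} {ε : Fin k → ℝ} (hε : ∀ i, 0 ≤ ε i) {Δ Δs η : ℝ}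
    (hΔs : 0 ≤ Δs) (hη : 0 ≤ η) (hΔ : Δs + η ≤ Δ)
    {P A : ℕ → Finset (EuclideanSpace ℝ (Fin n))}
    (hPQ : ∀ j, ∀ p ∈ P j, p ∈ Q) (h : IsArchiveSequence F ε Δ Δs P A)
    {s p : EuclideanSpace ℝ (Fin n)} {l : ℕ} (hs : s ∈ strictApproxSet F Q ε)
    (hp : p ∈ strictApproxSet F Q ε) (hpl : p ∈ P l) (hps : ‖F p - F s‖ ≤ η) :
    ∀ m ≥ l, ∃ a ∈ A m, ‖F a - F s‖ ≤ Δs + η := by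
  refine h.eventually (I := fun B => ∀ a ∈ B, a ∈ Q)
    (motive := fun B => ∃ a ∈ B, ‖F a - F s‖ ≤ Δs + η) hpl
    (fun B j q hq hB => archiveStep_subset hB (hPQ j q hq)) (by simp) ?_ ?_
  · intro B hB
    have h₁ : ¬ ∃ a ∈ B, NegDominates F ε a p := fun ⟨a, ha, hd⟩ => hp.2 ⟨a, hB a ha, hd.1⟩
    by_cases h₂ : ∃ a ∈ B, ‖F a - F p‖ ≤ Δs
    · rw [archiveStep, if_neg fun hc => hc.2 h₂]
      obtain ⟨a, ha, hap⟩ := h₂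
      exact ⟨a, ha, (norm_sub_le_norm_sub_add_norm_sub _ (F p) _).trans (add_le_add hap hps)⟩
    · exact ⟨p, mem_archiveStep_self (fun i => by linarith [hε i]) h₁ h₂, by linarith⟩
  · rintro B j q hq ⟨a, ha, has⟩
    -- Removal of `a` by `q` would give `F q + ε + Δ ≤ F a ≤ F s + Δs + η ≤ F s + Δ`, so `F q + ε ≤
    -- F s`.
    refine ⟨a, mem_archiveStep_of_mem ha fun hd => hs.2 ⟨q, hPQ j q hq, fun i => ?_⟩, has⟩
    have h₁ : F q i + (ε i + Δ) ≤ F a i := hd.1 i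
    have h₂ : F a i - F s i ≤ Δs + η :=
      (le_abs_self _).trans ((norm_le_pi_norm (F a - F s) i).trans has)
    simp only [Pi.add_apply]
    linarith

/-- An archive without mutual `-(ε + Δ)`-domination that approximates all Pareto images up to `Δ`
consists of points of `P_{Q,ε+2Δ}`. -/
theorem subset_approxParetoSet_of_approx {n k : ℕ} {F : EuclideanSpace ℝ (Fin n) → Fin k → ℝ}
    {Q : Set (EuclideanSpace ℝ (Fin n))} (hQ : IsCompact Q) (hF : ContinuousOn F Q)
    {ε : Fin k → ℝ} {Δ : ℝ} {A : Finset (EuclideanSpace ℝ (Fin n))} (hAQ : ∀ a ∈ A, a ∈ Q)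
    (hA : ∀ a₁ ∈ A, ∀ a₂ ∈ A, ¬ NegDominates F (fun i => ε i + Δ) a₁ a₂)
    (happrox : ∀ x ∈ paretoSet F Q, ∃ a ∈ A, ‖F a - F x‖ < Δ) :
    (A : Set (EuclideanSpace ℝ (Fin n))) ⊆ approxParetoSet F Q (fun i => ε i + 2 * Δ) := by
  refine fun a ha => ⟨hAQ a ha, ?_⟩
  rintro ⟨y, hy, hle, hne⟩
  obtain ⟨z, hz, hzy⟩ := exists_paretoSet_le hQ hF hy
  obtain ⟨b, hb, hbz⟩ := happrox z hz
  -- One `Δ` of the `2 * Δ` pays for passing from `z` to `b`; the other remains for the forbidden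
  -- domination.
  have hlt : ∀ i, F b i + (ε i + Δ) < F a i := by
    intro i
    have h₁ : F b i - F z i ≤ ‖F b - F z‖ :=
      (le_abs_self _).trans (norm_le_pi_norm (F b - F z) i)
    have h₂ : F y i + (ε i + 2 * Δ) ≤ F a i := hle i
    linarith [hzy i]
  -- An index must exist for the coordinatewise strict inequality to imply distinct vectors.
  obtain ⟨i, -⟩ := Function.ne_iff.1 hne
  exact hA b hb a ha ⟨fun j => (hlt j).le, fun h => (hlt i).ne (congrFun h i)⟩

theorem semiDist_mono_left {k : ℕ} {B B' : Set (Fin k → ℝ)} (h : B ⊆ B') (A : Set (Fin k → ℝ)) :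
    semiDist B A ≤ semiDist B' A :=
  biSup_mono h

theorem semiDist_image_le_ofReal {n k : ℕ} {F : EuclideanSpace ℝ (Fin n) → Fin k → ℝ}
    {B A : Set (EuclideanSpace ℝ (Fin n))} {r : ℝ} (h : ∀ x ∈ B, ∃ a ∈ A, ‖F a - F x‖ ≤ r) :
    semiDist (F '' B) (F '' A) ≤ ENNReal.ofReal r := by
  refine iSup₂_le ?_
  rintro _ ⟨x, hx, rfl⟩
  obtain ⟨a, ha, hax⟩ := h x hx
  refine (iInf₂_le (F a) ⟨a, ha, rfl⟩).trans ?_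
  rw [edist_dist, dist_eq_norm, norm_sub_rev]
  exact ENNReal.ofReal_le_ofReal hax

/-- Almost surely all images of points of `P_{Q,ε}` are finally approximated up to a common
constant smaller than `Δ`. -/
theorem ae_eventually_approx {n k : ℕ} {F : EuclideanSpace ℝ (Fin n) → Fin k → ℝ}
    {Q : Set (EuclideanSpace ℝ (Fin n))} (hQ : IsCompact Q) (hF : ContinuousOn F Q)
    {ε : Fin k → ℝ} (hε : ∀ i, 0 ≤ ε i) {Δ Δs : ℝ} (hΔs : 0 ≤ Δs) (hΔ : Δs < Δ)
    (hA3 : shiftedParetoSet F Q ε ⊆ interior Q)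
    (hA3' : ∀ x ∈ shiftedParetoSet F Q ε, DifferentiableAt ℝ F x ∧ qVec F x ≠ 0)
    {Ω : Type*} [MeasurableSpace Ω] (μ : Measure Ω)
    {P A : ℕ → Ω → Finset (EuclideanSpace ℝ (Fin n))}
    (hPQ : ∀ j ω, ∀ p ∈ P j ω, p ∈ Q)
    (hA : ∀ ω, IsArchiveSequence F ε Δ Δs (fun j => P j ω) (fun j => A j ω))
    (hhit : ∀ x ∈ Q, ∀ δ > 0, ∀ᵐ ω ∂μ, ∃ l, ∃ p ∈ P l ω, p ∈ Metric.ball x δ ∩ Q) :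
    ∃ r < Δ, ∀ᵐ ω ∂μ, ∃ l₀ : ℕ, ∀ l ≥ l₀, ∀ x ∈ approxParetoSet F Q ε,
      ∃ a ∈ A l ω, ‖F a - F x‖ ≤ r := by
  -- Three errors of size `η` occur: from `x` to the strict set, from there to the net, and from the
  -- net point to the sample. The fourth quarter leaves `r < Δ`, which keeps (b1) strict after the
  -- supremum.
  set η := (Δ - Δs) / 4 with hηdef
  have hη : 0 < η := by linarith
  refine ⟨Δs + 3 * η, by linarith, ?_⟩
  have htb : TotallyBounded (F '' strictApproxSet F Q ε) :=
    (hQ.image_of_continuousOn hF).totallyBounded.subset (Set.image_mono fun x hx => hx.1)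
  obtain ⟨T, hTS, hTfin, hTcov⟩ := Metric.finite_approx_of_totallyBounded htb η hη
  -- Finiteness of `T` serves twice: for one common null set here, and for one common `l₀` below.
  have hT : ∀ᵐ ω ∂μ, ∀ v ∈ T, ∃ l₀ : ℕ, ∀ l ≥ l₀, ∃ a ∈ A l ω, ‖F a - v‖ ≤ Δs + η := by
    refine (ae_ball_iff hTfin.countable).2 fun v hv => ?_
    obtain ⟨s, hs, rfl⟩ := hTS hv
    obtain ⟨δ, hδ, hball⟩ := strictApproxSet_nhds hQ hF hs hη
    filter_upwards [hhit s hs.1 δ hδ] with ω hω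
    obtain ⟨l, p, hpl, hp⟩ := hω
    obtain ⟨hpS, hps⟩ := hball p hp
    exact ⟨l, (hA ω).eventually_near hε hΔs hη.le (by linarith) (fun j => hPQ j ω) hs hpS hpl
      hps.le⟩
  filter_upwards [hT] with ω hω
  have hev : ∀ᶠ l in Filter.atTop, ∀ v ∈ T, ∃ a ∈ A l ω, ‖F a - v‖ ≤ Δs + η :=
    (Filter.eventually_all_finite hTfin).2 fun v hv => Filter.eventually_atTop.2 (hω v hv)
  obtain ⟨l₀, hl₀⟩ := Filter.eventually_atTop.1 hev
  refine ⟨l₀, fun l hl x hx => ?_⟩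
  obtain ⟨s, hs, hxs⟩ := exists_strictApproxSet_near hA3 hA3' hx hη
  obtain ⟨v, hv, hsv⟩ := Set.mem_iUnion₂.1 (hTcov ⟨s, hs, rfl⟩)
  obtain ⟨a, ha, hav⟩ := hl₀ l hl v hv
  refine ⟨a, ha, ?_⟩
  rw [mem_ball_iff_norm] at hsv
  have h₁ := norm_sub_le_norm_sub_add_norm_sub (F a) v (F x)
  have h₂ := norm_sub_le_norm_sub_add_norm_sub v (F s) (F x)
  rw [norm_sub_rev v (F s), norm_sub_rev (F s) (F x)] at h₂
  linarith

theorem mainTheorem1 {n k : ℕ} (F : EuclideanSpace ℝ (Fin n) → Fin k → ℝ)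
    (Q : Set (EuclideanSpace ℝ (Fin n))) (hQ : IsCompact Q) (hF : ContinuousOn F Q)
    (ε : Fin k → ℝ) (hε : ∀ i, 0 ≤ ε i)
    (Δ Δs : ℝ) (hΔs : 0 ≤ Δs) (hΔ : Δs < Δ)
    -- (A1)
    (hA1 : ∀ x ∈ Q \ paretoSet F Q, ¬ IsWeakPareto F Q x)
    -- (A2)
    (hA2 : ∀ x ∈ Q \ closure (approxParetoSet F Q ε), ¬ IsNegWeakPareto F Q ε x)
    -- (A3)
    (hA3 : shiftedParetoSet F Q ε ⊆ interior Q)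
    (hA3' : ∀ x ∈ shiftedParetoSet F Q ε, DifferentiableAt ℝ F x ∧ qVec F x ≠ 0)
    -- the random populations and the archives computed from them
    {Ω : Type*} [MeasurableSpace Ω] (μ : Measure Ω) [IsProbabilityMeasure μ]
    (P A : ℕ → Ω → Finset (EuclideanSpace ℝ (Fin n)))
    (hPQ : ∀ j ω, ∀ p ∈ P j ω, p ∈ Q)
    (hA : ∀ ω, IsArchiveSequence F ε Δ Δs (fun j => P j ω) (fun j => A j ω))
    (hhit : ∀ x ∈ Q, ∀ δ > 0, ∀ᵐ ω ∂μ, ∃ l, ∃ p ∈ P l ω, p ∈ Metric.ball x δ ∩ Q) :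
    -- (a)
    (∀ ω l, ∀ a₁ ∈ A l ω, ∀ a₂ ∈ A l ω, a₁ ≠ a₂ → Δs ≤ ‖F a₁ - F a₂‖) ∧
    -- (b)
    ∀ᵐ ω ∂μ, ∃ l₀ : ℕ, ∀ l ≥ l₀,
      semiDist (F '' approxParetoSet F Q ε) (F '' (A l ω : Set (EuclideanSpace ℝ (Fin n))))
          < ENNReal.ofReal Δ ∧
      semiDist (F '' (A l ω : Set (EuclideanSpace ℝ (Fin n)))) (F '' approxParetoSet F Q ε)
          ≤ semiDist (F '' approxParetoSet F Q (fun i => ε i + 2 * Δ))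
              (F '' approxParetoSet F Q ε) ∧
      hausDist (F '' approxParetoSet F Q ε) (F '' (A l ω : Set (EuclideanSpace ℝ (Fin n))))
          ≤ max (ENNReal.ofReal Δ)
              (semiDist (F '' approxParetoSet F Q (fun i => ε i + 2 * Δ))
                (F '' approxParetoSet F Q ε)) := by
  refine ⟨fun ω => (hA ω).invariant
    (motive := fun B => ∀ a₁ ∈ B, ∀ a₂ ∈ B, a₁ ≠ a₂ → Δs ≤ ‖F a₁ - F a₂‖)
    (fun B j p _ => pairwise_archiveStep p) (by simp), ?_⟩
  have hΔ0 : 0 < Δ := hΔs.trans_lt hΔ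
  obtain ⟨r, hr, hae⟩ := ae_eventually_approx hQ hF hε hΔs hΔ hA3 hA3' μ hPQ hA hhit
  filter_upwards [hae] with ω hω
  obtain ⟨l₀, hl₀⟩ := hω
  refine ⟨l₀, fun l hl => ?_⟩
  have hAQ : ∀ a ∈ A l ω, a ∈ Q := (hA ω).invariant (motive := fun B => ∀ a ∈ B, a ∈ Q)
    (fun B j p hp hB => archiveStep_subset hB (hPQ j ω p hp)) (by simp) l
  have hnd : ∀ a₁ ∈ A l ω, ∀ a₂ ∈ A l ω, ¬ NegDominates F (fun i => ε i + Δ) a₁ a₂ :=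
    (hA ω).invariant
      (motive := fun B => ∀ a₁ ∈ B, ∀ a₂ ∈ B, ¬ NegDominates F (fun i => ε i + Δ) a₁ a₂)
      (fun B j p _ => not_negDominates_archiveStep hΔ0.le p) (by simp) l
  have b1 : semiDist (F '' approxParetoSet F Q ε)
      (F '' (A l ω : Set (EuclideanSpace ℝ (Fin n)))) < ENNReal.ofReal Δ :=
    (semiDist_image_le_ofReal (hl₀ l hl)).trans_lt ((ENNReal.ofReal_lt_ofReal_iff hΔ0).2 hr)
  have hsub := subset_approxParetoSet_of_approx hQ hF hAQ hnd fun x hx =>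
    let ⟨a, ha, hax⟩ := hl₀ l hl x (paretoSet_subset_approxParetoSet F Q hε hx)
    ⟨a, ha, hax.trans_lt hr⟩
  have b2 := semiDist_mono_left (Set.image_mono (f := F) hsub) (F '' approxParetoSet F Q ε)
  exact ⟨b1, b2, max_le_max b1.le b2⟩
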